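/- \textbf{Model.} $n$ processes communicate through atomic operations on shared base objects and on descriptors. A descriptor has fields; $\mathrm{CreateNew}$ creates a descriptor with given contents and returns a pointer never returned before, and $\mathrm{ReadField}(d,f)$ (which returns the value of $f$), $\mathrm{WriteField}(d,f,v)$ and $\mathrm{CASField}(d,f,exp,v)$ (which stores $v$ in $f$ if $f$ contains $exp$, and returns the previous value of $f$) access a field $f$ of a descriptor $d$. With \emph{mutable descriptors}, these operations always take effect. With \emph{weak descriptors}, a descriptor $d$ created by a process $p$ becomes invalid as soon as $p$ performs another $\mathrm{CreateNew}$; operations on an invalid descriptor have no effect and return a special value $\bot$ that no field ever contains. An algorithm implements high-level operations, each consisting of one or more attempts, and has a procedure $\mathrm{Help}(d)$, whose argument is a descriptor and whose invocations may be nested. Executions are finite or infinite sequences of steps from the initial configuration. A step is trivial if it does not change the state of any shared object (descriptors included). A step is taken in an invocation of $\mathrm{Help}(d)$ if it is taken between the start and the return of this invocation, possibly in a nested invocation of $\mathrm{Help}$. \textbf{The class WCA.} An algorithm $\mathcal A$ that uses mutable descriptors is \emph{weak-compatible} if it is lock-free (whenever processes take infinitely many steps, infinitely many high-level operations complete) and,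 in each of its executions: (1) each attempt $O$ of a process $p$ creates at most one descriptor $d$; $p$ invokes $\mathrm{Help}(d)$ at most once, and only inside $O$; (2) $\mathrm{Help}(d')$ is invoked by other processes only on descriptors $d'$ that have been created by some attempt; (3) after the attempt that created $d$ has terminated, all steps taken in invocations of $\mathrm{Help}(d)$ are trivial; (4) while a process $q$ that did not create $d$ is performing $\mathrm{Help}(d)$, $q$ does not change any variable of its private memory that is still defined when this invocation of $\mathrm{Help}(d)$ ends (in particular, $q$ does not use a return value of $\mathrm{Help}(d)$); (5) every read, write or CAS of a field of $d$ occurs inside $\mathrm{Help}(d)$ or inside the attempt that created $d$. \textbf{The transformation.} $\mathcal A'$ is obtained from $\mathcal A$ by using weak descriptors and adding, after each $\mathrm{ReadField}$ and each $\mathrm{CASField}$ in the code of $\mathrm{Help}$, a check whether the response was $\bot$, in which case the process immediately returns from $\mathrm{Help}$. \textbf{Theorem.} Let $\mathcal A$ be a weak-compatible algorithm. For every execution $e'$ of $\mathcal A'$ there is an execution $e$ of $\mathcal A$ with the same high-level operations, in the same order and with the same responses, that is, with the same sequence of invocations and responses of high-level operations by the processes. Consequently, if $\mathcal A$ is linearizable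 (with respect to some sequential specification), then so is $\mathcal A'$. -/

import Mathlib

universe u

/-! ## Base objects, descriptors and algorithms -/

/-- The interface an algorithm is written against: the non-descriptor base objects with their
atomic operations, the descriptor pointers, fields and field values, and the high-level operations
(with their arguments) together with their responses. A descriptor type is recorded by one of the
fields. The value `⊥` returned by invalid descriptor operations is `none : Option Val`, so it is
never contained in a field. -/
structure Signature where
  Obj : Type u
  ObjState : Obj → Type u
  ObjReq : Obj → Type u
  ObjResp : Obj → Type u
  apply : (o : Obj) → ObjReq o → ObjState o → ObjState o × ObjResp o
  Ptr : Type u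
  Field : Type u
  Val : Type u
  HOp : Type u
  HResp : Type u

/-- One instruction of a process whose private memory has type `P` and whose current procedure
activation has local state (program counter and local variables) of type `L`. Except for `help`,
an instruction specifies the new private memory and local state as a function of the response of
the operation on shared memory. `help d l` invokes `Help(d)`; `l` is the local state in which the
caller resumes once that invocation has returned. -/
inductive Instr (S : Signature.{u}) (P L : Type u) : Type u
  | compute (next : P × L)
  | object (o : S.Obj) (a : S.ObjReq o) (next : S.ObjResp o → P × L)
  | createNew (contents : S.Field → S.Val) (next : S.Ptr → P × L)
  | readField (d : S.Ptr) (f : S.Field) (next : Option S.Val → P × L)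
  | writeField (d : S.Ptr) (f : S.Field) (v : S.Val) (next : P × L)
  | casField (d : S.Ptr) (f : S.Field) (exp new : S.Val) (next : Option S.Val → P × L)
  | help (d : S.Ptr) (next : L)

namespace Instr

variable {S : Signature.{u}} {P L : Type u}

/-- The descriptor on which `Help` is invoked, if any. -/
def helps : Instr S P L → Option S.Ptr
  | help d _ => some d
  | _ => none

/-- The descriptor one of whose fields is accessed (read, write or CAS), if any. -/
def accesses : Instr S P L → Option S.Ptr
  | readField d _ _ => some d
  | writeField d _ _ _ => some d
  | casField d _ _ _ _ => some d
  | _ => none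

end Instr

/-- Instructions of the code of high-level operations. `retry` ends the current operation attempt
and starts the next attempt of the same operation; `respond` ends the current attempt and the
operation. -/
inductive OpInstr (S : Signature.{u}) (P L : Type u) : Type u
  | act (i : Instr S P L)
  | retry (next : P × L)
  | respond (r : S.HResp)

/-- Instructions of the code of `Help`. -/
inductive HelpInstr (S : Signature.{u}) (P L : Type u) : Type u
  | act (i : Instr S P L)
  | ret

/-- An algorithm for `n` processes. `Priv` holds the variables of a process that are not local to
an invocation of `Help` and can be changed in it (a return value of `Help` is an assignment to such
a variable), `Loc` the program counter and local variables of the code of a high-level operation,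
and `HLoc` those of one invocation of `Help`. -/
structure Algorithm (n : ℕ) (S : Signature.{u}) where
  Priv : Type u
  Loc : Type u
  HLoc : Type u
  initMem : (o : S.Obj) → S.ObjState o
  initPriv : Fin n → Priv
  opEntry : S.HOp → Loc
  opCode : Priv → Loc → OpInstr S Priv Loc
  helpEntry : S.Ptr → HLoc
  helpCode : S.Ptr → Priv → HLoc → HelpInstr S Priv HLoc

/-! ## Shared memory and the two descriptor abstract data types -/

/-- Which descriptor ADT is used. -/
inductive ADT
  | mutableDesc
  | weakDesc

/-- A descriptor: its contents, the process that owns it, and the index (among the attempts of the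
owner) of the operation attempt that created it. -/
structure Descriptor (n : ℕ) (S : Signature.{u}) where
  contents : S.Field → S.Val
  owner : Fin n
  attempt : ℕ

/-- The shared memory: the states of the base objects, the descriptors created so far, and for each
process the descriptor it created last. -/
structure Shared (n : ℕ) (S : Signature.{u}) where
  mem : (o : S.Obj) → S.ObjState o
  desc : S.Ptr → Option (Descriptor n S)
  latest : Fin n → Option S.Ptr

namespace Shared

variable {n : ℕ} {S : Signature.{u}}

/-- A descriptor is valid from its creation until its owner creates another descriptor. -/
def Valid (sh : Shared n S) (d : S.Ptr) : Prop :=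
  ∃ r, sh.desc d = some r ∧ sh.latest r.owner = some d

open scoped Classical in
/-- The descriptor on which an operation on `d` takes effect: with weak descriptors, operations on
invalid descriptors have no effect and return `⊥`. -/
noncomputable def lookup (adt : ADT) (sh : Shared n S) (d : S.Ptr) : Option (Descriptor n S) :=
  match adt with
  | .mutableDesc => sh.desc d
  | .weakDesc => if sh.Valid d then sh.desc d else none

/-- The response of `ReadField(d, f)`; a CAS on this field has the same response. -/
noncomputable def read (adt : ADT) (sh : Shared n S) (d : S.Ptr) (f : S.Field) : Option S.Val :=
  (sh.lookup adt d).map fun r => r.contents f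

open scoped Classical in
/-- The effect of `WriteField(d, f, v)`. -/
noncomputable def write (adt : ADT) (sh : Shared n S) (d : S.Ptr) (f : S.Field) (v : S.Val) :
    Shared n S :=
  match sh.lookup adt d with
  | none => sh
  | some r =>
    { sh with
      desc := Function.update sh.desc d
        (some { r with contents := Function.update r.contents f v }) }

open scoped Classical in
/-- The effect of `CASField(d, f, exp, new)`. -/
noncomputable def cas (adt : ADT) (sh : Shared n S) (d : S.Ptr) (f : S.Field) (exp new : S.Val) :
    Shared n S :=
  if sh.read adt d f = some exp then sh.write adt d f new else sh

open scoped Classical in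
/-- The effect of an atomic operation on a non-descriptor base object. -/
noncomputable def applyObj (sh : Shared n S) (o : S.Obj) (a : S.ObjReq o) : Shared n S :=
  { sh with mem := Function.update sh.mem o (S.apply o a (sh.mem o)).1 }

open scoped Classical in
/-- The effect of a `CreateNew` that returns `d`, performed by `p` in its attempt number `k`. -/
noncomputable def create (sh : Shared n S) (p : Fin n) (k : ℕ) (d : S.Ptr)
    (contents : S.Field → S.Val) : Shared n S :=
  { sh with
    desc := Function.update sh.desc d (some ⟨contents, p, k⟩)
    latest := Function.update sh.latest p (some d) }

end Shared

/-- `Effect adt p k sh g i sh' g' l' call`: executing instruction `i` in attempt number `k` of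
process `p`, with shared memory `sh` and private memory `g`, can lead to shared memory `sh'`,
private memory `g'` and local state `l'`, and invokes `Help` on `call`, if this is not `none`.
`CreateNew` may return any pointer that it has never returned before. -/
inductive Effect {n : ℕ} {S : Signature.{u}} {P L : Type u} (adt : ADT) (p : Fin n) (k : ℕ)
    (sh : Shared n S) (g : P) :
    Instr S P L → Shared n S → P → L → Option S.Ptr → Prop
  | compute (next : P × L) :
      Effect adt p k sh g (.compute next) sh next.1 next.2 none
  | object (o : S.Obj) (a : S.ObjReq o) (next : S.ObjResp o → P × L) :
      Effect adt p k sh g (.object o a next) (sh.applyObj o a)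
        (next (S.apply o a (sh.mem o)).2).1 (next (S.apply o a (sh.mem o)).2).2 none
  | createNew (contents : S.Field → S.Val) (next : S.Ptr → P × L) (d : S.Ptr)
      (fresh : sh.desc d = none) :
      Effect adt p k sh g (.createNew contents next) (sh.create p k d contents)
        (next d).1 (next d).2 none
  | readField (d : S.Ptr) (f : S.Field) (next : Option S.Val → P × L) :
      Effect adt p k sh g (.readField d f next) sh
        (next (sh.read adt d f)).1 (next (sh.read adt d f)).2 none
  | writeField (d : S.Ptr) (f : S.Field) (v : S.Val) (next : P × L) :
      Effect adt p k sh g (.writeField d f v next) (sh.write adt d f v) next.1 next.2 none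
  | casField (d : S.Ptr) (f : S.Field) (exp new : S.Val) (next : Option S.Val → P × L) :
      Effect adt p k sh g (.casField d f exp new next) (sh.cas adt d f exp new)
        (next (sh.read adt d f)).1 (next (sh.read adt d f)).2 none
  | help (d : S.Ptr) (next : L) :
      Effect adt p k sh g (.help d next) sh g next (some d)

/-! ## Configurations, steps and executions -/

/-- The state of a process: its private memory, the local state of its current high-level operation
(`none` if it is idle), and the stack of its unfinished invocations of `Help`, innermost first, each
with the descriptor on which it was invoked and its local state. -/
structure ProcState {n : ℕ} {S : Signature.{u}} (A : Algorithm n S) where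
  priv : A.Priv
  cur : Option A.Loc
  stack : List (S.Ptr × A.HLoc)

/-- A configuration. `attempt p` is the number of operation attempts that `p` has completed, which
is also the index of its current attempt. -/
structure Config {n : ℕ} {S : Signature.{u}} (A : Algorithm n S) where
  shared : Shared n S
  attempt : Fin n → ℕ
  proc : Fin n → ProcState A

/-- Steps are labelled with the process that takes them, and the step that invokes or ends a
high-level operation also with that operation or its response. -/
inductive Label (n : ℕ) (S : Signature.{u}) : Type u
  | invoke (p : Fin n) (op : S.HOp)
  | respond (p : Fin n) (r : S.HResp)
  | internal (p : Fin n)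

/-- The process that takes the step. -/
def Label.proc {n : ℕ} {S : Signature.{u}} : Label n S → Fin n
  | invoke p _ => p
  | respond p _ => p
  | internal p => p

namespace Config

variable {n : ℕ} {S : Signature.{u}} {A : Algorithm n S}

/-- The initial configuration. -/
def initial (A : Algorithm n S) : Config A where
  shared := ⟨A.initMem, fun _ => none, fun _ => none⟩
  attempt := fun _ => 0
  proc := fun p => ⟨A.initPriv p, none, []⟩

/-- In the configuration `c`, process `p` is performing `Help(d)` (possibly with further
invocations of `Help` nested inside). -/
def InHelp (c : Config A) (p : Fin n) (d : S.Ptr) : Prop :=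
  ∃ h, (d, h) ∈ (c.proc p).stack

/-- The operation attempt that created the descriptor `r` has terminated. -/
def Terminated (c : Config A) (r : Descriptor n S) : Prop :=
  r.attempt < c.attempt r.owner

/-- The descriptor on which the next step of `p`, if it invokes `Help`, invokes it. -/
def helps (c : Config A) (p : Fin n) : Option S.Ptr :=
  match (c.proc p).cur, (c.proc p).stack with
  | none, _ => none
  | some l, [] =>
    match A.opCode (c.proc p).priv l with
    | .act i => i.helps
    | _ => none
  | some _, (d, h) :: _ =>
    match A.helpCode d (c.proc p).priv h with
    | .act i => i.helps
    | .ret => none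

/-- The descriptor a field of which is accessed by the next step of `p`, if there is one. -/
def accesses (c : Config A) (p : Fin n) : Option S.Ptr :=
  match (c.proc p).cur, (c.proc p).stack with
  | none, _ => none
  | some l, [] =>
    match A.opCode (c.proc p).priv l with
    | .act i => i.accesses
    | _ => none
  | some _, (d, h) :: _ =>
    match A.helpCode d (c.proc p).priv h with
    | .act i => i.accesses
    | .ret => none

end Config

/-- The steps of an algorithm. The descriptor operations follow the semantics of `adt`. -/
inductive Step {n : ℕ} {S : Signature.{u}} (adt : ADT) (A : Algorithm n S) :
    Config A → Label n S → Config A → Prop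
  | invoke (c : Config A) (p : Fin n) (op : S.HOp)
      (idle : (c.proc p).cur = none) :
      Step adt A c (.invoke p op)
        { c with
          proc := Function.update c.proc p ⟨(c.proc p).priv, some (A.opEntry op), []⟩ }
  | opAct (c : Config A) (p : Fin n) (l l' : A.Loc) (i : Instr S A.Priv A.Loc)
      (sh' : Shared n S) (g' : A.Priv) (call : Option S.Ptr)
      (cur : (c.proc p).cur = some l) (stack : (c.proc p).stack = [])
      (code : A.opCode (c.proc p).priv l = .act i)
      (eff : Effect adt p (c.attempt p) c.shared (c.proc p).priv i sh' g' l' call) :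
      Step adt A c (.internal p)
        { c with
          shared := sh'
          proc := Function.update c.proc p
            ⟨g', some l', (call.map fun d => (d, A.helpEntry d)).toList⟩ }
  | opRetry (c : Config A) (p : Fin n) (l : A.Loc) (next : A.Priv × A.Loc)
      (cur : (c.proc p).cur = some l) (stack : (c.proc p).stack = [])
      (code : A.opCode (c.proc p).priv l = .retry next) :
      Step adt A c (.internal p)
        { c with
          attempt := Function.update c.attempt p (c.attempt p + 1)
          proc := Function.update c.proc p ⟨next.1, some next.2, []⟩ }
  | opRespond (c : Config A) (p : Fin n) (l : A.Loc) (r : S.HResp)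
      (cur : (c.proc p).cur = some l) (stack : (c.proc p).stack = [])
      (code : A.opCode (c.proc p).priv l = .respond r) :
      Step adt A c (.respond p r)
        { c with
          attempt := Function.update c.attempt p (c.attempt p + 1)
          proc := Function.update c.proc p ⟨(c.proc p).priv, none, []⟩ }
  | helpAct (c : Config A) (p : Fin n) (l : A.Loc) (d : S.Ptr) (h h' : A.HLoc)
      (rest : List (S.Ptr × A.HLoc)) (i : Instr S A.Priv A.HLoc)
      (sh' : Shared n S) (g' : A.Priv) (call : Option S.Ptr)
      (cur : (c.proc p).cur = some l) (stack : (c.proc p).stack = (d, h) :: rest)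
      (code : A.helpCode d (c.proc p).priv h = .act i)
      (eff : Effect adt p (c.attempt p) c.shared (c.proc p).priv i sh' g' h' call) :
      Step adt A c (.internal p)
        { c with
          shared := sh'
          proc := Function.update c.proc p
            ⟨g', some l, (call.map fun d' => (d', A.helpEntry d')).toList ++ (d, h') :: rest⟩ }
  | helpRet (c : Config A) (p : Fin n) (l : A.Loc) (d : S.Ptr) (h : A.HLoc)
      (rest : List (S.Ptr × A.HLoc))
      (cur : (c.proc p).cur = some l) (stack : (c.proc p).stack = (d, h) :: rest)
      (code : A.helpCode d (c.proc p).priv h = .ret) :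
      Step adt A c (.internal p)
        { c with proc := Function.update c.proc p ⟨(c.proc p).priv, some l, rest⟩ }

/-- An execution, finite or infinite: `label i` is the label of the step from `conf i` to
`conf (i + 1)`, and `none` once the execution has ended. -/
structure Execution {n : ℕ} {S : Signature.{u}} (adt : ADT) (A : Algorithm n S) where
  conf : ℕ → Config A
  label : ℕ → Option (Label n S)
  start : conf 0 = Config.initial A
  step : ∀ i l, label i = some l → Step adt A (conf i) l (conf (i + 1))
  ended : ∀ i, label i = none → label (i + 1) = none ∧ conf (i + 1) = conf i

/-- Lock-freedom: if processes take infinitely many steps, then infinitely many high-level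
operations complete. -/
def LockFree {n : ℕ} {S : Signature.{u}} (adt : ADT) (A : Algorithm n S) : Prop :=
  ∀ e : Execution adt A, (∀ i, e.label i ≠ none) →
    ∀ m, ∃ i, m ≤ i ∧ ∃ p r, e.label i = some (.respond p r)

/-! ## Histories and linearizability -/

/-- Invocations and responses of high-level operations. -/
inductive Event (n : ℕ) (Op Res : Type u) : Type u
  | invoke (p : Fin n) (op : Op)
  | respond (p : Fin n) (r : Res)

/-- The process that performs the event. -/
def Event.proc {n : ℕ} {Op Res : Type u} : Event n Op Res → Fin n
  | invoke p _ => p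
  | respond p _ => p

/-- A finite or infinite sequence of events; the entries of a finite one are `none` from its end
on. -/
abbrev History (n : ℕ) (Op Res : Type u) : Type u := ℕ → Option (Event n Op Res)

/-- The event that a step performs, if any. -/
def Label.event {n : ℕ} {S : Signature.{u}} : Label n S → Option (Event n S.HOp S.HResp)
  | invoke p op => some (.invoke p op)
  | respond p r => some (.respond p r)
  | internal _ => none

/-- The events of the first `m` steps of an execution, in order. -/
def Execution.events {n : ℕ} {S : Signature.{u}} {adt : ADT} {A : Algorithm n S}
    (e : Execution adt A) (m : ℕ) : List (Event n S.HOp S.HResp) :=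
  (List.range m).filterMap fun i => (e.label i).bind Label.event

open scoped Classical in
/-- The sequence of all invocations and responses of high-level operations in an execution. -/
noncomputable def Execution.history {n : ℕ} {S : Signature.{u}} {adt : ADT} {A : Algorithm n S}
    (e : Execution adt A) : History n S.HOp S.HResp := fun k =>
  if h : ∃ m, k < (e.events m).length then (e.events (Nat.find h))[k]? else none

/-- A sequential specification: the prefix-closed set of the legal sequences of operations with
their responses. An infinite sequence is legal if its finite prefixes are. -/
structure SeqSpec (Op Res : Type u) where
  legal : Set (List (Op × Res))
  prefix_closed : ∀ l₁ l₂, l₁ <+: l₂ → l₂ ∈ legal → l₁ ∈ legal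

/-- The operation invoked by the event at position `i` of `H` ends with the response `r` at
position `j`. -/
def History.Responds {n : ℕ} {Op Res : Type u} (H : History n Op Res) (i j : ℕ) (r : Res) : Prop :=
  i < j ∧ ∃ p op, H i = some (.invoke p op) ∧ H j = some (.respond p r) ∧
    ∀ k, i < k → k < j → ∀ ev, H k = some ev → ev.proc ≠ p

/-- Linearizability. The event at position `i` of the history takes place at time `i`, and a
high-level operation is identified with the position of its invocation. All completed operations
and some of the pending ones, namely those where `lin` is not `none`, are given a linearization
point `pt`, after the invocation and before the response, such that the responses (`lin i` is the
operation at `i` with its response, chosen suitably if it is pending) are the same as if the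
operations were performed atomically at their linearization points. -/
def History.Linearizable {n : ℕ} {Op Res : Type u} (H : History n Op Res)
    (spec : SeqSpec Op Res) : Prop :=
  ∃ (lin : ℕ → Option (Op × Res)) (pt : ℕ → ℝ),
    (∀ i op r, lin i = some (op, r) → (∃ p, H i = some (.invoke p op)) ∧ (i : ℝ) < pt i) ∧
    (∀ i j r, H.Responds i j r → (∃ op, lin i = some (op, r)) ∧ pt i < (j : ℝ)) ∧
    ∀ t : ℝ, ∃ (l : List ℕ) (w : List (Op × Res)), l.Pairwise (fun i j => pt i < pt j) ∧
      (∀ i, i ∈ l ↔ (lin i).isSome ∧ pt i < t) ∧ l.map lin = w.map some ∧ w ∈ spec.legal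

/-- An algorithm is linearizable if all its executions are. -/
def Algorithm.Linearizable {n : ℕ} {S : Signature.{u}} (adt : ADT) (A : Algorithm n S)
    (spec : SeqSpec S.HOp S.HResp) : Prop :=
  ∀ e : Execution adt A, e.history.Linearizable spec

/-! ## Weak-compatible algorithms -/

/-- Weak-compatible algorithms: lock-free algorithms that use mutable descriptors such that, in
every execution,
* each operation attempt creates at most one descriptor `d`; the owner of `d` invokes `Help(d)` at
  most once, and only inside the attempt that created `d`; `Help` is invoked only on descriptors
  that have been created;
* all steps taken in an invocation of `Help(d)` after the termination of the attempt that created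
  `d` are trivial, i.e., do not change the shared memory;
* a process that performs `Help(d)` and does not own `d` does not change any of its variables that
  are not local to this invocation;
* fields of `d` are accessed only inside `Help(d)` or the attempt that created `d`. -/
structure Algorithm.IsWCA {n : ℕ} {S : Signature.{u}} (A : Algorithm n S) : Prop where
  lockFree : LockFree .mutableDesc A
  one_descriptor : ∀ (e : Execution .mutableDesc A) (t : ℕ) (d₁ d₂ : S.Ptr)
    (r₁ r₂ : Descriptor n S), (e.conf t).shared.desc d₁ = some r₁ →
    (e.conf t).shared.desc d₂ = some r₂ → r₁.owner = r₂.owner → r₁.attempt = r₂.attempt → d₁ = d₂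
  own_help_once : ∀ (e : Execution .mutableDesc A) (t₁ t₂ : ℕ) (a₁ a₂ : Label n S) (d : S.Ptr)
    (r : Descriptor n S), e.label t₁ = some a₁ → e.label t₂ = some a₂ →
    (e.conf t₁).shared.desc d = some r → a₁.proc = r.owner → a₂.proc = r.owner →
    (e.conf t₁).helps a₁.proc = some d → (e.conf t₂).helps a₂.proc = some d → t₁ = t₂
  help_created : ∀ (e : Execution .mutableDesc A) (t : ℕ) (a : Label n S) (d : S.Ptr),
    e.label t = some a → (e.conf t).helps a.proc = some d →
    ∃ r, (e.conf t).shared.desc d = some r ∧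
      (r.owner = a.proc → r.attempt = (e.conf t).attempt a.proc)
  help_trivial : ∀ (e : Execution .mutableDesc A) (t : ℕ) (a : Label n S) (d : S.Ptr)
    (r : Descriptor n S), e.label t = some a → (e.conf t).InHelp a.proc d →
    (e.conf t).shared.desc d = some r → (e.conf t).Terminated r →
    (e.conf (t + 1)).shared = (e.conf t).shared
  help_private : ∀ (e : Execution .mutableDesc A) (t : ℕ) (a : Label n S) (d : S.Ptr)
    (r : Descriptor n S), e.label t = some a → (e.conf t).InHelp a.proc d →
    (e.conf t).shared.desc d = some r → r.owner ≠ a.proc →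
    ((e.conf (t + 1)).proc a.proc).priv = ((e.conf t).proc a.proc).priv
  access_inside : ∀ (e : Execution .mutableDesc A) (t : ℕ) (a : Label n S) (d : S.Ptr),
    e.label t = some a → (e.conf t).accesses a.proc = some d →
    (e.conf t).InHelp a.proc d ∨
      ∃ r, (e.conf t).shared.desc d = some r ∧ r.owner = a.proc ∧
        r.attempt = (e.conf t).attempt a.proc

/-! ## The transformation -/

/-- Local states of the transformed `Help`: those of the original one, and the states in which the
response `resp` of a `ReadField` or `CASField` is about to be checked; `priv` and `loc` describe how
the original code continues. -/
inductive CheckedLoc (V P L : Type u) : Type u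
  | run (loc : L)
  | check (resp : Option V) (priv : P) (loc : L)

/-- A `ReadField` or `CASField` is followed by a check of its response (`g` is the current private
memory, which stays as it is until the check has succeeded); all other instructions are kept. -/
def Instr.addCheck {S : Signature.{u}} {P L : Type u} (g : P) :
    Instr S P L → Instr S P (CheckedLoc S.Val P L)
  | compute next => .compute (next.1, .run next.2)
  | object o a next => .object o a fun r => ((next r).1, .run (next r).2)
  | createNew contents next => .createNew contents fun d => ((next d).1, .run (next d).2)
  | readField d f next => .readField d f fun r => (g, .check r (next r).1 (next r).2)
  | writeField d f v next => .writeField d f v (next.1, .run next.2)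
  | casField d f exp new next =>
      .casField d f exp new fun r => (g, .check r (next r).1 (next r).2)
  | help d next => .help d (.run next)

/-- The transformed algorithm: after each `ReadField` and `CASField` in the code of `Help`, a check
is added which returns from `Help` immediately if the response was `⊥`. -/
def Algorithm.transform {n : ℕ} {S : Signature.{u}} (A : Algorithm n S) : Algorithm n S where
  Priv := A.Priv
  Loc := A.Loc
  HLoc := CheckedLoc S.Val A.Priv A.HLoc
  initMem := A.initMem
  initPriv := A.initPriv
  opEntry := A.opEntry
  opCode := A.opCode
  helpEntry := fun d => .run (A.helpEntry d)
  helpCode := fun d g h =>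
    match h with
    | .run loc =>
      match A.helpCode d g loc with
      | .act i => .act (i.addCheck g)
      | .ret => .ret
    | .check none _ _ => .ret
    | .check (some _) priv loc => .act (.compute (priv, .run loc))

/-!
The proof is a forward simulation in which the shared memory of the transformed algorithm, with weak
descriptors, and that of the original algorithm, with mutable descriptors, stay equal.

An owner creates at most one descriptor per attempt, so a descriptor can be invalid only if the
attempt that created it has terminated (`Run.terminated_of_not_valid`). Since fields of `d` are
accessed only in the attempt that created `d` or inside `Help(d)`, every access to an invalid
descriptor happens inside `Help` on a descriptor whose creating attempt has terminated
(`Run.valid_or_inHelp`), and there no step changes the shared memory or the private memory of the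
process (`Run.help_terminated`). In particular writes and CASs behave alike for both kinds of
descriptors.

It remains to simulate a process that receives `⊥` and returns from the innermost invocation of
`Help`. In the original algorithm this process instead takes solo steps until that invocation
returns. These steps have no effect on anything but the part of its stack that is discarded, and
there are finitely many of them by lock-freedom, because a process inside `Help` completes no
high-level operation (`Run.exists_help_return`). All other steps are simulated by the same step;
the step that performs a check is simulated by none (`ConfRel.simulate_step`).

The runs obtained by simulating longer and longer prefixes of an execution extend each other and
converge to an execution with the same history (`exists_execution_history_eq`).
-/

/-! ### Limits of growing lists -/

section Limit

variable {α : Type*}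

open scoped Classical in
/-- The finite or infinite sequence approximated by the lists `W 0`, `W 1`, …, each of which is
meant to be a prefix of the next. -/
noncomputable def listLimit (W : ℕ → List α) (k : ℕ) : Option α :=
  if h : ∃ m, k < (W m).length then (W (Nat.find h))[k]? else none

theorem prefix_of_le {W : ℕ → List α} (mono : ∀ i, W i <+: W (i + 1)) {i j : ℕ} (hij : i ≤ j) :
    W i <+: W j := by
  induction hij with
  | refl => exact List.prefix_refl _
  | step _ ih => exact ih.trans (mono _)

theorem getElem?_eq_of_prefix {l₁ l₂ : List α} (h : l₁ <+: l₂) {k : ℕ} (hk : k < l₁.length) :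
    l₂[k]? = l₁[k]? := by
  obtain ⟨t, rfl⟩ := h
  exact List.getElem?_append_left hk

theorem listLimit_eq {W : ℕ → List α} (mono : ∀ i, W i <+: W (i + 1)) {i k : ℕ}
    (hk : k < (W i).length) : listLimit W k = (W i)[k]? := by
  classical
  have h : ∃ m, k < (W m).length := ⟨i, hk⟩
  unfold listLimit
  rw [dif_pos h]
  exact (getElem?_eq_of_prefix (prefix_of_le mono (Nat.find_min' h hk)) (Nat.find_spec h)).symm

theorem listLimit_eq_none {W : ℕ → List α} {k : ℕ} (h : ¬ ∃ m, k < (W m).length) :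
    listLimit W k = none := by
  unfold listLimit
  rw [dif_neg h]

/-- Mutually cofinal sequences of growing lists have the same limit. -/
theorem listLimit_congr {V W : ℕ → List α} (hV : ∀ i, V i <+: V (i + 1))
    (hW : ∀ i, W i <+: W (i + 1)) (hVW : ∀ i, ∃ j, V i <+: W j) (hWV : ∀ i, ∃ j, W i <+: V j) :
    listLimit V = listLimit W := by
  funext k
  by_cases h : ∃ m, k < (V m).length
  · obtain ⟨m, hm⟩ := h
    obtain ⟨j, hj⟩ := hVW m
    rw [listLimit_eq hV hm, listLimit_eq hW (hm.trans_le hj.length_le),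
      getElem?_eq_of_prefix hj hm]
  · rw [listLimit_eq_none h, listLimit_eq_none]
    rintro ⟨m, hm⟩
    obtain ⟨j, hj⟩ := hWV m
    exact h ⟨j, hm.trans_le hj.length_le⟩

/-- Dependent choice for growing lists. -/
theorem exists_growing_lists {P : ℕ → List α → Prop} {W₀ : List α} (h₀ : P 0 W₀)
    (step : ∀ i W, P i W → ∃ W', P (i + 1) W' ∧ W <+: W') :
    ∃ W : ℕ → List α, (∀ i, P i (W i)) ∧ ∀ i, W i <+: W (i + 1) := by
  choose! next hnext using step
  let W : ℕ → List α := fun i => Nat.rec W₀ (fun i w => next i w) i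
  have hP : ∀ i, P i (W i) := by
    intro i
    induction i with
    | zero => exact h₀
    | succ i ih => exact (hnext i _ ih).1
  exact ⟨W, hP, fun i => (hnext i _ (hP i)).2⟩

end Limit

/-! ### Finite runs and the executions they approximate -/

section Runs

variable {n : ℕ} {S : Signature.{u}} {adt : ADT} {A : Algorithm n S}

/-- `Run adt A W c`: the list `W` records a finite sequence of steps from the initial configuration
to `c`, each with its label and the configuration that it leads to. -/
inductive Run (adt : ADT) (A : Algorithm n S) : List (Label n S × Config A) → Config A → Prop
  | nil : Run adt A [] (Config.initial A)
  | snoc {W : List (Label n S × Config A)} {c c' : Config A} {l : Label n S}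
      (run : Run adt A W c) (step : Step adt A c l c') : Run adt A (W ++ [(l, c')]) c'

/-- The events performed in a list of steps. -/
def traceEvents (W : List (Label n S × Config A)) : List (Event n S.HOp S.HResp) :=
  W.filterMap fun x => x.1.event

/-- The configuration after the first `t` steps of the sequence `s`. -/
def confAfter (s : ℕ → Option (Label n S × Config A)) : ℕ → Config A
  | 0 => Config.initial A
  | t + 1 =>
    match s t with
    | none => confAfter s t
    | some x => x.2

theorem confAfter_congr {s₁ s₂ : ℕ → Option (Label n S × Config A)} {t : ℕ}
    (h : ∀ i < t, s₁ i = s₂ i) : confAfter s₁ t = confAfter s₂ t := by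
  induction t with
  | zero => rfl
  | succ t ih =>
    have ht := Nat.lt_succ_self t
    simp only [confAfter, h t ht, ih fun i hi => h i (hi.trans ht)]

theorem Run.confAfter_length {W : List (Label n S × Config A)} {c : Config A}
    (h : Run adt A W c) : confAfter (fun t => W[t]?) W.length = c := by
  cases h with
  | nil => rfl
  | snoc => simp [confAfter]

theorem Run.step_getElem? {W : List (Label n S × Config A)} {c : Config A} (h : Run adt A W c)
    {t : ℕ} {x : Label n S × Config A} (hx : W[t]? = some x) :
    Step adt A (confAfter (fun i => W[i]?) t) x.1 x.2 := by
  induction h with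
  | nil => simp at hx
  | @snoc W c c' l run step ih =>
    have hc : ∀ t ≤ W.length, confAfter (fun i => (W ++ [(l, c')])[i]?) t =
        confAfter (fun i => W[i]?) t := fun t ht =>
      confAfter_congr fun i hi => List.getElem?_append_left (hi.trans_le ht)
    obtain ht | ht | ht := lt_trichotomy t W.length
    · rw [List.getElem?_append_left ht] at hx
      rw [hc t ht.le]
      exact ih hx
    · subst ht
      rw [List.getElem?_concat_length] at hx
      cases hx
      rw [hc _ le_rfl, run.confAfter_length]
      exact step
    · rw [List.getElem?_eq_none (by simp; omega)] at hx
      cases hx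

/-- Growing runs converge to an execution. It ends if their lengths are bounded. -/
theorem exists_execution_of_runs {W : ℕ → List (Label n S × Config A)}
    (mono : ∀ i, W i <+: W (i + 1)) (hrun : ∀ i, ∃ c, Run adt A (W i) c) :
    ∃ e : Execution adt A,
      (∀ i t x, (W i)[t]? = some x → e.label t = some x.1 ∧ e.conf (t + 1) = x.2) ∧
      (∀ i c, Run adt A (W i) c → e.conf (W i).length = c) ∧
      ∀ t, e.label t ≠ none → ∃ i, t < (W i).length := by
  have hlim : ∀ i t, t < (W i).length → listLimit W t = (W i)[t]? := fun i t ht =>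
    listLimit_eq mono ht
  have hconf : ∀ i t, t ≤ (W i).length →
      confAfter (listLimit W) t = confAfter (fun k => (W i)[k]?) t := fun i t ht =>
    confAfter_congr fun k hk => hlim i k (hk.trans_le ht)
  have hex : ∀ t, listLimit W t ≠ none → ∃ i, t < (W i).length := fun t ht => by
    by_contra hno
    exact ht (listLimit_eq_none hno)
  refine ⟨⟨confAfter (listLimit W), fun t => (listLimit W t).map Prod.fst, rfl, ?_, ?_⟩,
    ?_, ?_, ?_⟩
  · intro t l hl
    obtain ⟨x, hx, rfl⟩ := Option.map_eq_some_iff.1 hl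
    obtain ⟨i, hi⟩ := hex t (by simp [hx])
    obtain ⟨c, hc⟩ := hrun i
    have hstep := hc.step_getElem? ((hlim i t hi).symm.trans hx)
    rw [← hconf i t hi.le] at hstep
    simpa only [confAfter, hx] using hstep
  · intro t hl
    have hx : listLimit W t = none := by simpa using hl
    refine ⟨?_, by simp only [confAfter, hx]⟩
    have hno : ¬ ∃ i, t + 1 < (W i).length := by
      rintro ⟨i, hi⟩
      have ht : t < (W i).length := by omega
      rw [hlim i t ht, List.getElem?_eq_none_iff] at hx
      omega
    simp [listLimit_eq_none hno]
  · intro i t x hx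
    have ht : t < (W i).length := (List.getElem?_eq_some_iff.1 hx).1
    have hl : listLimit W t = some x := (hlim i t ht).trans hx
    exact ⟨by simp [hl], by simp only [confAfter, hl]⟩
  · intro i c hc
    exact (hconf i _ le_rfl).trans hc.confAfter_length
  · intro t ht
    exact hex t fun h => ht (by simp [h])

theorem Run.exists_execution {W : List (Label n S × Config A)} {c c' : Config A} {l : Label n S}
    (h : Run adt A W c) (hs : Step adt A c l c') :
    ∃ (e : Execution adt A) (t : ℕ), e.conf t = c ∧ e.label t = some l ∧ e.conf (t + 1) = c' := by
  -- The first run ends in `c`; from then on the sequence is constant, and its limit ends in `c'`.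
  obtain ⟨e, h₁, h₂, -⟩ := exists_execution_of_runs (adt := adt) (A := A)
    (W := fun i => if i = 0 then W else W ++ [(l, c')])
    (by intro i; by_cases hi : i = 0 <;> simp [hi])
    (by
      intro i
      by_cases hi : i = 0
      · exact ⟨c, by simpa [hi] using h⟩
      · exact ⟨c', by simpa [hi] using h.snoc hs⟩)
  have h₃ := h₁ 1 W.length (l, c') (by simp)
  exact ⟨e, W.length, h₂ 0 c h, h₃.1, h₃.2⟩

theorem Execution.events_succ (e : Execution adt A) (m : ℕ) :
    e.events (m + 1) = e.events m ++ ((e.label m).bind Label.event).toList := by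
  unfold Execution.events
  rw [List.range_succ, List.filterMap_append]
  cases h : (e.label m).bind Label.event <;> simp [h]

theorem Execution.history_eq_listLimit (e : Execution adt A) : e.history = listLimit e.events :=
  rfl

theorem Execution.events_length {e : Execution adt A} {W : List (Label n S × Config A)}
    (h : ∀ t x, W[t]? = some x → e.label t = some x.1) : e.events W.length = traceEvents W := by
  induction W using List.reverseRecOn with
  | nil => rfl
  | append_singleton W x ih =>
    have hx := h W.length x (by simp)
    have hW := ih fun t y hy => h t y (by
      rw [List.getElem?_append_left (List.getElem?_eq_some_iff.1 hy).1, hy])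
    rw [List.length_append, List.length_singleton, Execution.events_succ, hW, hx]
    cases hev : x.1.event <;> simp [traceEvents, hev]

/-- If growing runs perform the same events as the finite prefixes of an execution (possibly of
another algorithm), then they converge to an execution with the same history. -/
theorem exists_execution_history_eq {adt' : ADT} {A' : Algorithm n S} (e' : Execution adt' A')
    {W : ℕ → List (Label n S × Config A)} (mono : ∀ i, W i <+: W (i + 1))
    (hrun : ∀ i, ∃ c, Run adt A (W i) c) (hev : ∀ i, traceEvents (W i) = e'.events i) :
    ∃ e : Execution adt A, e.history = e'.history := by
  obtain ⟨e, h₁, -, h₃⟩ := exists_execution_of_runs mono hrun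
  have hlen : ∀ i, e.events (W i).length = e'.events i := fun i =>
    (Execution.events_length fun t x hx => (h₁ i t x hx).1).trans (hev i)
  have hmono : ∀ i, e.events i <+: e.events (i + 1) := fun i => by
    rw [e.events_succ]; exact List.prefix_append _ _
  refine ⟨e, ?_⟩
  rw [e.history_eq_listLimit, e'.history_eq_listLimit]
  refine listLimit_congr hmono
    (fun i => by rw [e'.events_succ]; exact List.prefix_append _ _) ?_
    fun i => ⟨(W i).length, by rw [hlen]⟩
  intro m
  induction m with
  | zero => exact ⟨0, List.nil_prefix⟩
  | succ m ih =>
    by_cases hm : e.label m = none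
    · rw [e.events_succ, hm]
      simpa using ih
    · obtain ⟨i, hi⟩ := h₃ m hm
      exact ⟨i, by rw [← hlen i]; exact prefix_of_le hmono hi⟩

end Runs

/-! ### Descriptor operations -/

namespace Shared

variable {n : ℕ} {S : Signature.{u}} {sh : Shared n S} {d : S.Ptr}

/-- The owner of a descriptor and the attempt that created it; unlike the contents, they never
change. -/
def tag (sh : Shared n S) (d : S.Ptr) : Option (Fin n × ℕ) :=
  (sh.desc d).map fun r => (r.owner, r.attempt)

theorem tag_eq_none : sh.tag d = none ↔ sh.desc d = none := by
  simp [tag]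

theorem tag_eq_some {p : Fin n} {k : ℕ} :
    sh.tag d = some (p, k) ↔ ∃ r, sh.desc d = some r ∧ r.owner = p ∧ r.attempt = k := by
  simp [tag]

theorem tag_write (f : S.Field) (v : S.Val) : (sh.write .mutableDesc d f v).tag = sh.tag := by
  funext x
  unfold write lookup
  cases h : sh.desc d with
  | none => rfl
  | some r =>
    by_cases hx : x = d
    · subst hx; simp [tag, h]
    · simp [tag, hx]

theorem latest_write (f : S.Field) (v : S.Val) :
    (sh.write .mutableDesc d f v).latest = sh.latest := by
  unfold write
  split <;> rfl

theorem tag_create (p : Fin n) (k : ℕ) (contents : S.Field → S.Val) :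
    (sh.create p k d contents).tag d = some (p, k) ∧
      ∀ x ≠ d, (sh.create p k d contents).tag x = sh.tag x := by
  refine ⟨by simp [tag, create], fun x hx => by simp [tag, create, hx]⟩

theorem lookup_eq_of_valid (h : sh.Valid d) :
    sh.lookup .weakDesc d = sh.lookup .mutableDesc d := by
  simp [lookup, h]

theorem lookup_eq_none_of_not_valid (h : ¬ sh.Valid d) : sh.lookup .weakDesc d = none := by
  simp [lookup, h]

variable {adt adt' : ADT}

theorem read_congr (h : sh.lookup adt d = sh.lookup adt' d) (f : S.Field) :
    sh.read adt d f = sh.read adt' d f := by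
  simp only [read, h]

theorem write_congr (h : sh.lookup adt d = sh.lookup adt' d) (f : S.Field) (v : S.Val) :
    sh.write adt d f v = sh.write adt' d f v := by
  simp only [write, h]

theorem cas_congr (h : sh.lookup adt d = sh.lookup adt' d) (f : S.Field) (exp new : S.Val) :
    sh.cas adt d f exp new = sh.cas adt' d f exp new := by
  unfold cas
  rw [read_congr h, write_congr h]

theorem read_of_lookup_eq_none (h : sh.lookup adt d = none) (f : S.Field) :
    sh.read adt d f = none := by
  simp [read, h]

theorem write_of_lookup_eq_none (h : sh.lookup adt d = none) (f : S.Field) (v : S.Val) :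
    sh.write adt d f v = sh := by
  simp [write, h]

theorem cas_of_lookup_eq_none (h : sh.lookup adt d = none) (f : S.Field) (exp new : S.Val) :
    sh.cas adt d f exp new = sh := by
  simp [cas, read_of_lookup_eq_none h]

end Shared

section Effects

variable {n : ℕ} {S : Signature.{u}} {P L : Type u} {p : Fin n} {k : ℕ} {sh sh' : Shared n S}
  {g g' : P} {l' : L} {i : Instr S P L} {call : Option S.Ptr}

theorem Effect.tag_cases (h : Effect .mutableDesc p k sh g i sh' g' l' call) :
    (sh'.tag = sh.tag ∧ sh'.latest = sh.latest) ∨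
      ∃ d, sh.tag d = none ∧ (sh'.tag d = some (p, k) ∧ ∀ x ≠ d, sh'.tag x = sh.tag x) ∧
        sh'.latest = Function.update sh.latest p (some d) := by
  cases h with
  | compute => exact .inl ⟨rfl, rfl⟩
  | object => exact .inl ⟨rfl, rfl⟩
  | createNew contents next d fresh =>
    refine .inr ⟨d, Shared.tag_eq_none.2 fresh, Shared.tag_create _ _ _, ?_⟩
    unfold Shared.create
    congr!
  | readField => exact .inl ⟨rfl, rfl⟩
  | writeField => exact .inl ⟨Shared.tag_write _ _, Shared.latest_write _ _⟩
  | casField =>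
    refine .inl ?_
    unfold Shared.cas
    split
    · exact ⟨Shared.tag_write _ _, Shared.latest_write _ _⟩
    · exact ⟨rfl, rfl⟩
  | help => exact .inl ⟨rfl, rfl⟩

theorem Effect.tag_mono (h : Effect .mutableDesc p k sh g i sh' g' l' call) {d : S.Ptr}
    {x : Fin n × ℕ} (hd : sh.tag d = some x) : sh'.tag d = some x := by
  obtain ⟨h₁, -⟩ | ⟨d₁, hd₁, ⟨-, h₁⟩, -⟩ := h.tag_cases
  · rw [h₁, hd]
  · have hne : d ≠ d₁ := by rintro rfl; simp [hd] at hd₁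
    rw [h₁ d hne, hd]

theorem Effect.helps_eq {adt : ADT} (h : Effect adt p k sh g i sh' g' l' call) :
    i.helps = call := by
  cases h <;> rfl

/-- As long as only finitely many descriptors exist, every instruction can be executed. -/
theorem Effect.exists_mutable [Infinite S.Ptr] (hfin : {d | sh.tag d ≠ none}.Finite) (p : Fin n)
    (k : ℕ) (g : P) (i : Instr S P L) :
    ∃ sh' g' l' call, Effect .mutableDesc p k sh g i sh' g' l' call := by
  cases i with
  | compute next => exact ⟨_, _, _, _, .compute next⟩
  | object o a next => exact ⟨_, _, _, _, .object o a next⟩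
  | createNew contents next =>
    obtain ⟨d, hd⟩ := hfin.exists_notMem
    exact ⟨_, _, _, _, .createNew contents next d
      (Shared.tag_eq_none.1 (by simpa using hd))⟩
  | readField d f next => exact ⟨_, _, _, _, .readField d f next⟩
  | writeField d f v next => exact ⟨_, _, _, _, .writeField d f v next⟩
  | casField d f exp new next => exact ⟨_, _, _, _, .casField d f exp new next⟩
  | help d next => exact ⟨_, _, _, _, .help d next⟩

theorem Effect.mutable_of_weak (h : Effect .weakDesc p k sh g i sh' g' l' call)
    (hacc : ∀ d, i.accesses = some d → sh.lookup .weakDesc d = sh.lookup .mutableDesc d) :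
    Effect .mutableDesc p k sh g i sh' g' l' call := by
  cases h with
  | compute next => exact .compute next
  | object o a next => exact .object o a next
  | createNew contents next d fresh => exact .createNew contents next d fresh
  | readField d f next =>
    rw [Shared.read_congr (hacc d rfl)]
    exact .readField d f next
  | writeField d f v next =>
    rw [Shared.write_congr (hacc d rfl)]
    exact .writeField d f v next
  | casField d f exp new next =>
    rw [Shared.read_congr (hacc d rfl), Shared.cas_congr (hacc d rfl)]
    exact .casField d f exp new next
  | help d => exact .help d _

/-- An instruction of the transformed `Help` that does not access an invalid descriptor has the
effect of the original instruction, except that the new private memory and local state may still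
await the check of a response, which will succeed. -/
theorem Effect.mutable_of_addCheck {h' : CheckedLoc S.Val P L}
    (h : Effect .weakDesc p k sh g (i.addCheck g) sh' g' h' call)
    (hacc : ∀ d, i.accesses = some d → sh.Valid d) :
    ∃ g₁ loc, Effect .mutableDesc p k sh g i sh' g₁ loc call ∧
      ((h' = .run loc ∧ g' = g₁) ∨ (call = none ∧ ∃ v, h' = .check (some v) g₁ loc)) := by
  have hread : ∀ d, i.accesses = some d → ∀ f, ∃ v,
      sh.read .weakDesc d f = some v ∧ sh.read .mutableDesc d f = some v := by
    intro d hd f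
    have hl := Shared.lookup_eq_of_valid (hacc d hd)
    obtain ⟨r, hr, -⟩ := hacc d hd
    have : sh.read .mutableDesc d f = some (r.contents f) := by
      simp [Shared.read, Shared.lookup, hr]
    exact ⟨_, (Shared.read_congr hl f).trans this, this⟩
  cases i with
  | compute next => cases h; exact ⟨_, _, .compute next, .inl ⟨rfl, rfl⟩⟩
  | object o a next => cases h; exact ⟨_, _, .object o a next, .inl ⟨rfl, rfl⟩⟩
  | createNew contents next =>
    cases h with
    | createNew _ _ d fresh => exact ⟨_, _, .createNew contents _ d fresh, .inl ⟨rfl, rfl⟩⟩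
  | readField d f next =>
    cases h
    obtain ⟨v, hv, hv'⟩ := hread d rfl f
    exact ⟨_, _, .readField d f next, .inr ⟨rfl, v, by rw [hv, hv']⟩⟩
  | writeField d f v next =>
    cases h
    rw [Shared.write_congr (Shared.lookup_eq_of_valid (hacc d rfl))]
    exact ⟨_, _, .writeField d f v next, .inl ⟨rfl, rfl⟩⟩
  | casField d f exp new next =>
    cases h
    obtain ⟨v, hv, hv'⟩ := hread d rfl f
    rw [Shared.cas_congr (Shared.lookup_eq_of_valid (hacc d rfl))]
    exact ⟨_, _, .casField d f exp new next, .inr ⟨rfl, v, by rw [hv, hv']⟩⟩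
  | help d next => cases h; exact ⟨_, _, .help d next, .inl ⟨rfl, rfl⟩⟩

/-- An instruction of the transformed `Help` that accesses an invalid descriptor has no effect; if
it is not a write, then its response is going to fail the check. -/
theorem Effect.of_addCheck_not_valid {h' : CheckedLoc S.Val P L} {d : S.Ptr}
    (h : Effect .weakDesc p k sh g (i.addCheck g) sh' g' h' call)
    (hacc : i.accesses = some d) (hd : ¬ sh.Valid d) :
    sh' = sh ∧ call = none ∧
      ((g' = g ∧ ∃ g₁ loc, h' = .check none g₁ loc) ∨
        ∃ f v loc, i = .writeField d f v (g', loc) ∧ h' = .run loc) := by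
  have hl := Shared.lookup_eq_none_of_not_valid hd
  cases i with
  | readField d f next =>
    cases hacc; cases h
    exact ⟨rfl, rfl, .inl ⟨rfl, _, _, by rw [Shared.read_of_lookup_eq_none hl]⟩⟩
  | writeField d f v next =>
    cases hacc; cases h
    exact ⟨Shared.write_of_lookup_eq_none hl _ _, rfl, .inr ⟨f, v, _, rfl, rfl⟩⟩
  | casField d f exp new next =>
    cases hacc; cases h
    exact ⟨Shared.cas_of_lookup_eq_none hl _ _ _, rfl,
      .inl ⟨rfl, _, _, by rw [Shared.read_of_lookup_eq_none hl]⟩⟩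
  | _ => cases hacc

end Effects

/-! ### Reachable configurations of weak-compatible algorithms -/

section Invariants

variable {n : ℕ} {S : Signature.{u}} {A : Algorithm n S}

/-- Only finitely many descriptors exist, and of all the descriptors that a process has created, the
one that it created last stems from the latest attempt, which is not later than the current one. -/
structure DescInv (sh : Shared n S) (attempt : Fin n → ℕ) : Prop where
  finite : {d | sh.tag d ≠ none}.Finite
  attempt_le : ∀ d p k, sh.tag d = some (p, k) → k ≤ attempt p
  latest : ∀ d p k, sh.tag d = some (p, k) →
    ∃ d' k', sh.latest p = some d' ∧ sh.tag d' = some (p, k') ∧ k ≤ k'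

/-- The unfinished invocations of `Help` by `p` are on existing descriptors, and those on
descriptors owned by `p` are on the one created in the current attempt. -/
def StackInv (sh : Shared n S) (p : Fin n) (k : ℕ) {H : Type u} (stack : List (S.Ptr × H)) : Prop :=
  ∀ x ∈ stack, ∃ q j, sh.tag x.1 = some (q, j) ∧ (q = p → j = k)

/-- The invariants of the configurations of a weak-compatible algorithm. -/
structure ConfInv (c : Config A) : Prop where
  desc : DescInv c.shared c.attempt
  stack : ∀ p, StackInv c.shared p (c.attempt p) (c.proc p).stack

theorem DescInv.effect {P L : Type u} {p : Fin n} {sh sh' : Shared n S} {attempt : Fin n → ℕ}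
    {g g' : P} {l' : L} {i : Instr S P L} {call : Option S.Ptr} (hI : DescInv sh attempt)
    (h : Effect .mutableDesc p (attempt p) sh g i sh' g' l' call) : DescInv sh' attempt := by
  obtain ⟨ht, hl⟩ | ⟨d, hd, ⟨htd, ht⟩, hl⟩ := h.tag_cases
  · exact ⟨by rw [ht]; exact hI.finite, by rw [ht]; exact hI.attempt_le,
      by rw [ht, hl]; exact hI.latest⟩
  · refine ⟨(hI.finite.insert d).subset ?_, ?_, ?_⟩
    · intro x hx
      by_cases hxd : x = d
      · exact .inl hxd
      · exact .inr (by simpa [ht x hxd] using hx)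
    · intro x q k hx
      by_cases hxd : x = d
      · subst hxd
        cases htd.symm.trans hx
        exact le_rfl
      · exact hI.attempt_le x q k (by rw [← ht x hxd, hx])
    · intro x q k hx
      have hk : k ≤ attempt q := by
        by_cases hxd : x = d
        · subst hxd
          cases htd.symm.trans hx
          exact le_rfl
        · exact hI.attempt_le x q k (by rw [← ht x hxd, hx])
      by_cases hq : q = p
      · subst hq
        exact ⟨d, attempt q, by rw [hl]; simp, htd, hk⟩
      · have hxd : x ≠ d := by
          rintro rfl
          cases htd.symm.trans hx
          exact hq rfl
        obtain ⟨d', k', h₁, h₂, h₃⟩ := hI.latest x q k (by rw [← ht x hxd, hx])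
        exact ⟨d', k', by rw [hl]; simpa [hq] using h₁, h.tag_mono h₂, h₃⟩

theorem DescInv.attempt_mono {sh : Shared n S} {a b : Fin n → ℕ} (hI : DescInv sh a)
    (hab : ∀ p, a p ≤ b p) : DescInv sh b :=
  ⟨hI.finite, fun d p k h => (hI.attempt_le d p k h).trans (hab p), hI.latest⟩

theorem StackInv.effect {P L : Type u} {p q : Fin n} {k j : ℕ} {sh sh' : Shared n S} {g g' : P}
    {l' : L} {i : Instr S P L} {call : Option S.Ptr} {H : Type u} {stack : List (S.Ptr × H)}
    (hI : StackInv sh q j stack) (h : Effect .mutableDesc p k sh g i sh' g' l' call) :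
    StackInv sh' q j stack := fun x hx => by
  obtain ⟨q, j, h₁, h₂⟩ := hI x hx
  exact ⟨q, j, h.tag_mono h₁, h₂⟩

theorem StackInv.nil {sh : Shared n S} {p : Fin n} {k : ℕ} {H : Type u} :
    StackInv sh p k ([] : List (S.Ptr × H)) := by
  simp [StackInv]

theorem StackInv.update {sh : Shared n S} {attempt attempt' : Fin n → ℕ} {p : Fin n}
    {proc : Fin n → ProcState A} {s : ProcState A} (ha : ∀ q ≠ p, attempt' q = attempt q)
    (hI : ∀ q ≠ p, StackInv sh q (attempt q) (proc q).stack)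
    (hs : StackInv sh p (attempt' p) s.stack) (q : Fin n) :
    StackInv sh q (attempt' q) (Function.update proc p s q).stack := by
  by_cases hq : q = p
  · subst hq
    simpa using hs
  · rw [Function.update_of_ne hq, ha q hq]
    exact hI q hq

section

variable {W : List (Label n S × Config A)} {c c' : Config A} {l : Label n S}

theorem Algorithm.IsWCA.stackInv_call (hA : A.IsWCA) (hrun : Run .mutableDesc A W c)
    (hs : Step .mutableDesc A c l c') {H : Type u} {call : Option S.Ptr} {entry : S.Ptr → H}
    (hcall : c.helps l.proc = call) :
    StackInv c.shared l.proc (c.attempt l.proc)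
      (call.map fun d => (d, entry d)).toList := by
  intro x hx
  obtain ⟨d, rfl, rfl⟩ : ∃ d, call = some d ∧ (d, entry d) = x := by simpa using hx
  obtain ⟨e, t, rfl, hl, -⟩ := hrun.exists_execution hs
  obtain ⟨r, hr, hr'⟩ := hA.help_created e t l d hl hcall
  exact ⟨r.owner, r.attempt, Shared.tag_eq_some.2 ⟨r, hr, rfl, rfl⟩, hr'⟩

theorem ConfInv.step (hA : A.IsWCA) (hrun : Run .mutableDesc A W c)
    (hs : Step .mutableDesc A c l c') (hI : ConfInv c) : ConfInv c' := by
  have hcall := fun call => @Algorithm.IsWCA.stackInv_call _ _ _ _ _ _ _ hA hrun hs _ call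
    A.helpEntry
  cases hs with
  | invoke p op idle =>
    exact ⟨hI.desc, StackInv.update (fun _ _ => rfl) (fun q _ => hI.stack q) .nil⟩
  | opAct p l l' i sh' g' call cur stack code eff =>
    refine ⟨hI.desc.effect eff,
      StackInv.update (fun _ _ => rfl) (fun q _ => (hI.stack q).effect eff) ?_⟩
    refine StackInv.effect (hcall call ?_) eff
    simp [Config.helps, Label.proc, cur, stack, code, eff.helps_eq]
  | opRetry p l next cur stack code =>
    refine ⟨hI.desc.attempt_mono fun q => ?_,
      StackInv.update (fun q hq => by simp [hq]) (fun q _ => hI.stack q) .nil⟩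
    by_cases hq : q = p
    · subst hq; simp
    · simp [hq]
  | opRespond p l r cur stack code =>
    refine ⟨hI.desc.attempt_mono fun q => ?_,
      StackInv.update (fun q hq => by simp [hq]) (fun q _ => hI.stack q) .nil⟩
    by_cases hq : q = p
    · subst hq; simp
    · simp [hq]
  | helpAct p l d h h' rest i sh' g' call cur stack code eff =>
    refine ⟨hI.desc.effect eff,
      StackInv.update (fun _ _ => rfl) (fun q _ => (hI.stack q).effect eff) ?_⟩
    refine StackInv.effect (k := c.attempt p) ?_ eff
    intro x hx
    obtain hx | hx := List.mem_append.1 hx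
    · refine hcall call ?_ x hx
      simp [Config.helps, Label.proc, cur, stack, code, eff.helps_eq]
    · have hst := hI.stack p
      rw [stack] at hst
      obtain rfl | hx := List.mem_cons.1 hx
      · exact hst (d, h) (by simp)
      · exact hst x (by simp [hx])
  | helpRet p l d h rest cur stack code =>
    refine ⟨hI.desc, StackInv.update (fun _ _ => rfl) (fun q _ => hI.stack q) ?_⟩
    have hst := hI.stack p
    rw [stack] at hst
    exact fun x hx => hst x (by simp [show x ∈ rest from hx])

theorem Run.confInv (hA : A.IsWCA) (hrun : Run .mutableDesc A W c) : ConfInv c := by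
  induction hrun with
  | nil =>
    exact ⟨⟨by simp [Config.initial, Shared.tag], by simp [Config.initial, Shared.tag],
      by simp [Config.initial, Shared.tag]⟩, fun _ => .nil⟩
  | snoc run step ih => exact ih.step hA run step

/-- A descriptor can only become invalid by the creation of another one, which happens in a later
attempt. -/
theorem Run.terminated_of_not_valid (hA : A.IsWCA) (hrun : Run .mutableDesc A W c)
    (hs : Step .mutableDesc A c l c') {d : S.Ptr} {r : Descriptor n S}
    (hd : c.shared.desc d = some r) (hv : ¬ c.shared.Valid d) : c.Terminated r := by
  have hI := (hrun.confInv hA).desc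
  obtain ⟨d', k', h₁, h₂, h₃⟩ :=
    hI.latest d r.owner r.attempt (Shared.tag_eq_some.2 ⟨r, hd, rfl, rfl⟩)
  have h₄ := hI.attempt_le _ _ _ h₂
  obtain ⟨r', hr', ho, rfl⟩ := Shared.tag_eq_some.1 h₂
  refine lt_of_lt_of_le (lt_of_le_of_ne h₃ fun heq => ?_) h₄
  obtain ⟨e, t, rfl, -, -⟩ := hrun.exists_execution hs
  obtain rfl := hA.one_descriptor e t d d' r r' hd hr' ho.symm heq
  exact hv ⟨r, hd, h₁⟩

/-- While a process performs `Help` on a descriptor whose creating attempt has terminated, its steps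
change neither the shared memory nor its private memory. -/
theorem Run.help_terminated (hA : A.IsWCA) (hrun : Run .mutableDesc A W c)
    (hs : Step .mutableDesc A c l c') {d : S.Ptr} {r : Descriptor n S}
    (hd : c.shared.desc d = some r) (hin : c.InHelp l.proc d) (hr : c.Terminated r) :
    c'.shared = c.shared ∧ (c'.proc l.proc).priv = (c.proc l.proc).priv := by
  have hne : r.owner ≠ l.proc := by
    intro ho
    obtain ⟨h, hh⟩ := hin
    obtain ⟨q, k, htag, hk⟩ := (hrun.confInv hA).stack _ _ hh
    cases (Shared.tag_eq_some.2 ⟨r, hd, rfl, rfl⟩).symm.trans htag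
    have := hk ho
    unfold Config.Terminated at hr
    rw [this, ho] at hr
    exact lt_irrefl _ hr
  obtain ⟨e, t, rfl, hl, rfl⟩ := hrun.exists_execution hs
  exact ⟨hA.help_trivial e t l d r hl hin hd hr, hA.help_private e t l d r hl hin hd hne⟩

/-- A descriptor that is accessed is valid, or the access happens inside `Help` on it after the
attempt that created it has terminated. -/
theorem Run.valid_or_inHelp (hA : A.IsWCA) (hrun : Run .mutableDesc A W c)
    (hs : Step .mutableDesc A c l c') {d : S.Ptr} (hacc : c.accesses l.proc = some d) :
    c.shared.Valid d ∨
      c.InHelp l.proc d ∧ ∃ r, c.shared.desc d = some r ∧ c.Terminated r := by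
  have hterm : ∀ r, c.shared.desc d = some r → ¬ c.shared.Valid d → c.Terminated r :=
    fun r hr hv => hrun.terminated_of_not_valid hA hs hr hv
  have hI := hrun.confInv hA
  by_cases hv : c.shared.Valid d
  · exact .inl hv
  refine .inr ?_
  obtain ⟨e, t, rfl, hl, -⟩ := hrun.exists_execution hs
  obtain hin | ⟨r, hr, ho, hatt⟩ := hA.access_inside e t l d hl hacc
  · obtain ⟨h, hh⟩ := hin
    obtain ⟨q, k, htag, -⟩ := hI.stack _ _ hh
    obtain ⟨r, hr, -⟩ := Shared.tag_eq_some.1 htag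
    exact ⟨⟨h, hh⟩, r, hr, hterm r hr hv⟩
  · have := hterm r hr hv
    unfold Config.Terminated at this
    rw [hatt, ho] at this
    exact absurd this (lt_irrefl _)

end

end Invariants

/-! ### Completing an invocation of `Help` by solo steps -/

section Completion

variable {n : ℕ} {S : Signature.{u}} {A : Algorithm n S}

theorem traceEvents_eq_nil {V : List (Label n S × Config A)} {p : Fin n}
    (h : ∀ x ∈ V, x.1 = .internal p) : traceEvents V = [] := by
  refine List.filterMap_eq_nil_iff.2 fun x hx => ?_
  rw [h x hx]
  rfl

variable {W : List (Label n S × Config A)} {c : Config A} {p : Fin n}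

/-- Inside an invocation of `Help` on the descriptor of a terminated attempt, `p` can take a step
that changes nothing but the part of its stack above `rest`. -/
theorem Run.solo_step [Infinite S.Ptr] (hA : A.IsWCA) (hrun : Run .mutableDesc A W c)
    {g : A.Priv} {l : A.Loc} {d : S.Ptr} {h : A.HLoc} {pre rest : List (S.Ptr × A.HLoc)}
    (hp : c.proc p = ⟨g, some l, pre ++ (d, h) :: rest⟩) {d' : S.Ptr} {r : Descriptor n S}
    (hd' : d' ∈ ((d, h) :: rest).map Prod.fst) (hr : c.shared.desc d' = some r)
    (hterm : c.Terminated r) :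
    ∃ stack, (stack = rest ∨ ∃ pre' h', stack = pre' ++ (d, h') :: rest) ∧
      Step .mutableDesc A c (.internal p)
        { c with proc := Function.update c.proc p ⟨g, some l, stack⟩ } := by
  have hin : c.InHelp p d' := by
    obtain ⟨x, hx, rfl⟩ := List.mem_map.1 hd'
    exact ⟨x.2, by rw [hp]; exact List.mem_append_right _ hx⟩
  obtain ⟨d₀, h₀, tail, htop, hret, hact⟩ : ∃ d₀ h₀ tail,
      pre ++ (d, h) :: rest = (d₀, h₀) :: tail ∧
      (tail = rest ∨ ∃ pre' h', tail = pre' ++ (d, h') :: rest) ∧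
      ∀ h₁, ∃ pre' h', (d₀, h₁) :: tail = pre' ++ (d, h') :: rest := by
    cases pre with
    | nil => exact ⟨d, h, rest, rfl, .inl rfl, fun h₁ => ⟨[], h₁, rfl⟩⟩
    | cons x pre => exact ⟨x.1, x.2, pre ++ (d, h) :: rest, rfl, .inr ⟨pre, h, rfl⟩,
        fun h₁ => ⟨(x.1, h₁) :: pre, h, rfl⟩⟩
  rw [htop] at hp
  cases hcode : A.helpCode d₀ g h₀ with
  | ret =>
    refine ⟨tail, hret, ?_⟩
    have := Step.helpRet (adt := .mutableDesc) c p l d₀ h₀ tail (by rw [hp]) (by rw [hp])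
      (by rw [hp]; exact hcode)
    rwa [hp] at this
  | act i =>
    obtain ⟨sh', g', h₁, call, heff⟩ :=
      Effect.exists_mutable (hrun.confInv hA).desc.finite p (c.attempt p) (c.proc p).priv i
    have hs := Step.helpAct (adt := .mutableDesc) c p l d₀ h₀ h₁ tail i sh' g' call
      (by rw [hp]) (by rw [hp]) (by rw [hp]; exact hcode) heff
    obtain ⟨hsh, hg⟩ := hrun.help_terminated hA hs hr hin hterm
    have hg : g' = g := by simpa [Label.proc, hp] using hg
    have hsh : sh' = c.shared := hsh
    subst hg hsh
    refine ⟨_, .inr ?_, hs⟩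
    obtain ⟨pre', h', heq⟩ := hact h₁
    exact ⟨(call.map fun d' => (d', A.helpEntry d')).toList ++ pre', h', by
      rw [heq, List.append_assoc]⟩

/-- By lock-freedom, a process that performs `Help` on the descriptor of a terminated attempt can
return from the current invocation of `Help` by solo steps that do not affect anything else. -/
theorem Run.exists_help_return [Infinite S.Ptr] (hA : A.IsWCA) (hrun : Run .mutableDesc A W c)
    {g : A.Priv} {l : A.Loc} {d : S.Ptr} {h : A.HLoc} {rest : List (S.Ptr × A.HLoc)}
    (hp : c.proc p = ⟨g, some l, (d, h) :: rest⟩) {d' : S.Ptr} {r : Descriptor n S}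
    (hd' : c.InHelp p d') (hr : c.shared.desc d' = some r) (hterm : c.Terminated r) :
    ∃ V, traceEvents V = [] ∧ Run .mutableDesc A (W ++ V)
      { c with proc := Function.update c.proc p ⟨g, some l, rest⟩ } := by
  have hmem : d' ∈ ((d, h) :: rest).map Prod.fst := by
    obtain ⟨x, hx⟩ := hd'
    rw [hp] at hx
    exact List.mem_map_of_mem hx
  let solo (stack : List (S.Ptr × A.HLoc)) : Config A :=
    { c with proc := Function.update c.proc p ⟨g, some l, stack⟩ }
  -- After the solo steps `V`, the process has not yet returned from the invocation.
  let Busy (V : List (Label n S × Config A)) : Prop :=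
    (∀ x ∈ V, x.1 = .internal p) ∧
      ∃ pre h', Run .mutableDesc A (W ++ V) (solo (pre ++ (d, h') :: rest))
  have hstep : ∀ V, Busy V → ∃ y, y.1 = Label.internal p ∧
      (Run .mutableDesc A (W ++ (V ++ [y])) (solo rest) ∨ Busy (V ++ [y])) := by
    rintro V ⟨hV, pre, h', hrunV⟩
    obtain ⟨stack, hst, hs⟩ := hrunV.solo_step hA (p := p) (g := g) (l := l)
      (d := d) (h := h') (pre := pre) (rest := rest) (by simp [solo])
      (by simpa using hmem) (r := r) hr hterm
    have heq : { solo (pre ++ (d, h') :: rest) with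
        proc := Function.update (solo (pre ++ (d, h') :: rest)).proc p ⟨g, some l, stack⟩ } =
        solo stack := by
      simp [solo]
    rw [heq] at hs
    have hrun' := hrunV.snoc hs
    rw [List.append_assoc] at hrun'
    refine ⟨(.internal p, solo stack), rfl, ?_⟩
    obtain rfl | ⟨pre', h'', rfl⟩ := hst
    · exact .inl hrun'
    · refine .inr ⟨?_, pre', h'', hrun'⟩
      intro x hx
      obtain hx | hx := List.mem_append.1 hx
      · exact hV x hx
      · rw [List.mem_singleton.1 hx]
  by_contra hno
  have hbusy : ∀ V, Busy V → ∃ y, Busy (V ++ [y]) := by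
    intro V hV
    obtain ⟨y, hy, hy' | hy'⟩ := hstep V hV
    · refine absurd ⟨V ++ [y], traceEvents_eq_nil (p := p) ?_, hy'⟩ hno
      intro x hx
      obtain hx | hx := List.mem_append.1 hx
      · exact hV.1 x hx
      · rw [List.mem_singleton.1 hx, hy]
    · exact ⟨y, hy'⟩
  have hbusy₀ : Busy [] := by
    refine ⟨by simp, [], h, ?_⟩
    have : solo ([] ++ (d, h) :: rest) = c := by
      simp only [solo, List.nil_append, ← hp, Function.update_eq_self]
    rw [this, List.append_nil]
    exact hrun
  obtain ⟨V, hV, hmono⟩ := exists_growing_lists (P := fun i V => Busy V ∧ i ≤ V.length)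
    (W₀ := []) ⟨hbusy₀, le_rfl⟩ (by
      rintro i V ⟨hV, hi⟩
      obtain ⟨y, hy⟩ := hbusy V hV
      exact ⟨V ++ [y], ⟨hy, by simpa using hi⟩, List.prefix_append _ _⟩)
  -- The growing solo runs converge to an infinite execution without responses after `W`.
  obtain ⟨e, he, -, -⟩ := exists_execution_of_runs (adt := .mutableDesc) (A := A)
    (W := fun i => W ++ V i) (fun i => (List.prefix_append_right_inj W).2 (hmono i))
    fun i => let ⟨pre, h', hr⟩ := (hV i).1.2; ⟨_, hr⟩
  have hlabel : ∀ t, ∃ x, (W ++ V (t + 1))[t]? = some x ∧ e.label t = some x.1 := by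
    intro t
    have hlen := (hV (t + 1)).2
    have ht : t < (W ++ V (t + 1)).length := by rw [List.length_append]; omega
    exact ⟨_, List.getElem?_eq_getElem ht, (he (t + 1) t _ (List.getElem?_eq_getElem ht)).1⟩
  obtain ⟨t, ht, q, res, hres⟩ := hA.lockFree e (fun t => by
    obtain ⟨x, -, hx⟩ := hlabel t
    simp [hx]) W.length
  obtain ⟨x, hx, hxl⟩ := hlabel t
  rw [List.getElem?_append_right ht] at hx
  rw [(hV (t + 1)).1.1 x (List.mem_of_getElem? hx), hres] at hxl
  cases hxl

end Completion

/-! ### The simulation -/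

section Simulation

variable {n : ℕ} {S : Signature.{u}} {A : Algorithm n S}

/-- The stack of the transformed algorithm that corresponds to a stack of the original one, if no
check is pending. -/
def liftStack (stack : List (S.Ptr × A.HLoc)) : List (S.Ptr × A.transform.HLoc) :=
  stack.map fun x => (x.1, .run x.2)

/-- The simulation relation between the states of a process in the original and in the transformed
algorithm. The original algorithm is ahead while a check is pending: if the check will succeed, then
it has already updated the private memory and the local state; if it will fail, then it has already
returned from the innermost invocation of `Help`. -/
inductive ProcRel : ProcState A → ProcState A.transform → Prop
  | run (g : A.Priv) (cur : Option A.Loc) (stack : List (S.Ptr × A.HLoc)) :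
      ProcRel ⟨g, cur, stack⟩ ⟨g, cur, liftStack stack⟩
  | pass (g g' : A.Priv) (l : A.Loc) (d : S.Ptr) (v : S.Val) (h : A.HLoc)
      (rest : List (S.Ptr × A.HLoc)) :
      ProcRel ⟨g, some l, (d, h) :: rest⟩
        ⟨g', some l, (d, .check (some v) g h) :: liftStack rest⟩
  | fail (g g₁ : A.Priv) (l : A.Loc) (d : S.Ptr) (h : A.HLoc) (rest : List (S.Ptr × A.HLoc)) :
      ProcRel ⟨g, some l, rest⟩ ⟨g, some l, (d, .check none g₁ h) :: liftStack rest⟩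

/-- The simulation relation between configurations of the original and the transformed algorithm:
the shared memories are equal. -/
structure ConfRel (c : Config A) (c' : Config A.transform) : Prop where
  shared : c.shared = c'.shared
  attempt : c.attempt = c'.attempt
  proc : ∀ p, ProcRel (c.proc p) (c'.proc p)

theorem ProcRel.of_stack_eq_nil {s : ProcState A} {s' : ProcState A.transform} (h : ProcRel s s')
    (hs : s'.stack = []) : s = ⟨s'.priv, s'.cur, []⟩ := by
  cases h with
  | run g cur stack =>
    obtain rfl : stack = [] := List.map_eq_nil_iff.1 hs
    rfl
  | pass => cases hs
  | fail => cases hs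

theorem ProcRel.of_cur_eq_none {s : ProcState A} {s' : ProcState A.transform} (h : ProcRel s s')
    (hs : s'.cur = none) : s.cur = none ∧ s.priv = s'.priv := by
  cases h with
  | run g cur stack => exact ⟨hs, rfl⟩
  | pass => cases hs
  | fail => cases hs

theorem ProcRel.of_stack_eq_cons {s : ProcState A} {s' : ProcState A.transform} (h : ProcRel s s')
    {l : A.Loc} {d : S.Ptr} {h' : A.transform.HLoc} {rest' : List (S.Ptr × A.transform.HLoc)}
    (hl : s'.cur = some l) (hs : s'.stack = (d, h') :: rest') :
    ∃ rest, rest' = liftStack rest ∧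
      ((∃ h, h' = .run h ∧ s = ⟨s'.priv, some l, (d, h) :: rest⟩) ∨
        (∃ v g h, h' = .check (some v) g h ∧ s = ⟨g, some l, (d, h) :: rest⟩) ∨
        ∃ g h, h' = .check none g h ∧ s = ⟨s'.priv, some l, rest⟩) := by
  cases h with
  | run g cur stack =>
    cases stack with
    | nil => cases hs
    | cons x rest =>
      cases hs; cases hl
      exact ⟨rest, rfl, .inl ⟨x.2, rfl, rfl⟩⟩
  | pass g g' l d v h rest =>
    cases hs; cases hl
    exact ⟨rest, rfl, .inr (.inl ⟨v, g, h, rfl, rfl⟩)⟩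
  | fail g g₁ l d h rest =>
    cases hs; cases hl
    exact ⟨rest, rfl, .inr (.inr ⟨g₁, h, rfl, rfl⟩)⟩

theorem ConfRel.initial : ConfRel (Config.initial A) (Config.initial A.transform) :=
  ⟨rfl, rfl, fun p => .run (A.initPriv p) none []⟩

theorem ProcRel.update {proc : Fin n → ProcState A} {proc' : Fin n → ProcState A.transform}
    (h : ∀ p, ProcRel (proc p) (proc' p)) {p : Fin n} {s : ProcState A}
    {s' : ProcState A.transform} (hs : ProcRel s s') (q : Fin n) :
    ProcRel (Function.update proc p s q) (Function.update proc' p s' q) := by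
  by_cases hq : q = p
  · subst hq
    simpa using hs
  · simpa [hq] using h q

theorem ProcRel.update_right {proc : Fin n → ProcState A} {proc' : Fin n → ProcState A.transform}
    (h : ∀ p, ProcRel (proc p) (proc' p)) {p : Fin n} {s' : ProcState A.transform}
    (hs : ProcRel (proc p) s') (q : Fin n) : ProcRel (proc q) (Function.update proc' p s' q) := by
  have := ProcRel.update h (p := p) hs q
  rwa [Function.update_eq_self] at this

theorem Algorithm.transform_helpCode_run {d : S.Ptr} {g : A.Priv} {h : A.HLoc}
    {i' : Instr S A.transform.Priv A.transform.HLoc}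
    (hcode : A.transform.helpCode d g (.run h) = .act i') :
    ∃ i, A.helpCode d g h = .act i ∧ i' = i.addCheck g := by
  cases hc : A.helpCode d g h with
  | ret => simp [Algorithm.transform, hc] at hcode
  | act i =>
    refine ⟨i, rfl, ?_⟩
    simp only [Algorithm.transform, hc] at hcode
    cases hcode
    rfl

theorem Algorithm.transform_helpCode_run_ret {d : S.Ptr} {g : A.Priv} {h : A.HLoc}
    (hcode : A.transform.helpCode d g (.run h) = .ret) : A.helpCode d g h = .ret := by
  cases hc : A.helpCode d g h with
  | ret => rfl
  | act i => simp [Algorithm.transform, hc] at hcode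

variable {W : List (Label n S × Config A)} {c : Config A} {c' : Config A.transform}

/-- The simulation relation is preserved by a step of the transformed algorithm in which the process
is about to execute an instruction of the original `Help`. -/
theorem ConfRel.simulate_helpAct [Infinite S.Ptr] (hA : A.IsWCA) (hrun : Run .mutableDesc A W c)
    (hR : ConfRel c c') {p : Fin n} {l : A.Loc} {d : S.Ptr} {h : A.HLoc}
    {rest : List (S.Ptr × A.HLoc)} (hp : c.proc p = ⟨(c'.proc p).priv, some l, (d, h) :: rest⟩)
    {i : Instr S A.Priv A.HLoc} (hcode : A.helpCode d (c'.proc p).priv h = .act i)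
    {sh' : Shared n S} {g' : A.Priv} {h' : CheckedLoc S.Val A.Priv A.HLoc} {call : Option S.Ptr}
    (heff : Effect .weakDesc p (c'.attempt p) c'.shared (c'.proc p).priv
      (i.addCheck (c'.proc p).priv) sh' g' h' call) :
    ∃ V c₁, Run .mutableDesc A (W ++ V) c₁ ∧ traceEvents V = [] ∧
      ConfRel c₁ { c' with
        shared := sh'
        proc := Function.update c'.proc p ⟨g', some l,
          (call.map fun d' => (d', A.transform.helpEntry d')).toList ++
            ((d, h') :: liftStack rest : List (S.Ptr × A.transform.HLoc))⟩ } := by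
  rw [← hR.shared, ← hR.attempt] at heff
  have hstep : ∀ {sh₁ g₁ h₁ call₁},
      Effect .mutableDesc p (c.attempt p) c.shared (c'.proc p).priv i sh₁ g₁ h₁ call₁ →
      Step .mutableDesc A c (.internal p) { c with
        shared := sh₁
        proc := Function.update c.proc p ⟨g₁, some l,
          (call₁.map fun d' => (d', A.helpEntry d')).toList ++ (d, h₁) :: rest⟩ } := by
    intro sh₁ g₁ h₁ call₁ heff₁
    exact .helpAct c p l d h h₁ rest i sh₁ g₁ call₁ (by rw [hp]) (by rw [hp])
      (by rw [hp]; exact hcode) (by rw [hp]; exact heff₁)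
  by_cases hvalid : ∀ d', i.accesses = some d' → c.shared.Valid d'
  · obtain ⟨g₁, h₁, heff₁, ⟨rfl, rfl⟩ | ⟨rfl, v, rfl⟩⟩ := heff.mutable_of_addCheck hvalid
    · refine ⟨_, _, hrun.snoc (hstep heff₁), rfl, rfl, hR.attempt, ProcRel.update hR.proc ?_⟩
      cases call with
      | none => exact .run g' (some l) ((d, h₁) :: rest)
      | some d' => exact .run g' (some l) ((d', A.helpEntry d') :: (d, h₁) :: rest)
    · exact ⟨_, _, hrun.snoc (hstep heff₁), rfl, rfl, hR.attempt,
        ProcRel.update hR.proc (.pass _ _ _ _ _ _ _)⟩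
  · push Not at hvalid
    obtain ⟨d', hacc, hd'⟩ := hvalid
    have hin : c.InHelp p d' ∧ ∃ r, c.shared.desc d' = some r ∧ c.Terminated r := by
      obtain ⟨sh₁, g₁, h₁, call₁, heff₁⟩ := Effect.exists_mutable
        (hrun.confInv hA).desc.finite p (c.attempt p) (c'.proc p).priv i
      refine (hrun.valid_or_inHelp hA (hstep heff₁) ?_).resolve_left hd'
      simp [Config.accesses, Label.proc, hp, hcode, hacc]
    obtain ⟨hin, r, hr, hterm⟩ := hin
    obtain ⟨rfl, rfl, ⟨rfl, g₁, h₁, rfl⟩ | ⟨f, v, h₁, rfl, rfl⟩⟩ :=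
      heff.of_addCheck_not_valid hacc hd'
    · obtain ⟨V, hV, hrunV⟩ := hrun.exists_help_return hA hp hin hr hterm
      exact ⟨V, _, hrunV, hV, rfl, hR.attempt, ProcRel.update hR.proc (.fail _ _ _ _ _ _)⟩
    · -- The write takes effect on mutable descriptors, but it is a trivial step.
      have hs := hstep (.writeField d' f v (g', h₁))
      have hsh := (hrun.help_terminated hA hs hr hin hterm).1
      exact ⟨_, _, hrun.snoc hs, rfl, hsh, hR.attempt,
        ProcRel.update hR.proc (.run g' (some l) ((d, h₁) :: rest))⟩

/-- Every step of the transformed algorithm is simulated by a finite, possibly empty, sequence of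
steps of the original one that performs the same events. -/
theorem ConfRel.simulate_step [Infinite S.Ptr] (hA : A.IsWCA) (hrun : Run .mutableDesc A W c)
    (hR : ConfRel c c') {a : Label n S} {c₁' : Config A.transform}
    (hs : Step .weakDesc A.transform c' a c₁') :
    ∃ V c₁, Run .mutableDesc A (W ++ V) c₁ ∧ traceEvents V = a.event.toList ∧
      ConfRel c₁ c₁' := by
  cases hs with
  | invoke p op idle =>
    obtain ⟨hcur, hpriv⟩ := (hR.proc p).of_cur_eq_none idle
    refine ⟨_, _, hrun.snoc (.invoke c p op hcur), rfl, hR.shared, hR.attempt,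
      ProcRel.update hR.proc ?_⟩
    rw [hpriv]
    exact .run _ _ []
  | opAct p l l' i sh' g' call cur stack code eff =>
    have hp := (hR.proc p).of_stack_eq_nil stack
    rw [cur] at hp
    rw [← hR.shared, ← hR.attempt] at eff
    have hstep : ∀ {sh₁ g₁ l₁ call₁},
        Effect .mutableDesc p (c.attempt p) c.shared (c'.proc p).priv i sh₁ g₁ l₁ call₁ →
        Step .mutableDesc A c (.internal p) { c with
          shared := sh₁
          proc := Function.update c.proc p ⟨g₁, some l₁,
            (call₁.map fun d' => (d', A.helpEntry d')).toList⟩ } := by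
      intro sh₁ g₁ l₁ call₁ heff₁
      exact .opAct c p l l₁ i sh₁ g₁ call₁ (congrArg ProcState.cur hp) (congrArg ProcState.stack hp)
        (by rw [hp]; exact code) (by rw [hp]; exact heff₁)
    have heff := eff.mutable_of_weak fun d hacc => by
      refine Shared.lookup_eq_of_valid ?_
      obtain ⟨sh₁, g₁, l₁, call₁, heff₁⟩ := Effect.exists_mutable
        (hrun.confInv hA).desc.finite p (c.attempt p) (c'.proc p).priv i
      refine (hrun.valid_or_inHelp hA (hstep heff₁) ?_).resolve_right ?_
      · have code' : A.opCode (c'.proc p).priv l = .act i := code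
        simp only [Config.accesses, Label.proc, hp, code']
        exact hacc
      · rintro ⟨⟨h, hh⟩, -⟩
        simp [Label.proc, hp] at hh
    refine ⟨_, _, hrun.snoc (hstep heff), rfl, rfl, hR.attempt, ProcRel.update hR.proc ?_⟩
    cases call with
    | none => exact .run (A := A) g' (some l') []
    | some d => exact .run (A := A) g' (some l') [(d, A.helpEntry d)]
  | opRetry p l next cur stack code =>
    have hp := (hR.proc p).of_stack_eq_nil stack
    rw [cur] at hp
    exact ⟨_, _, hrun.snoc (.opRetry c p l next (congrArg ProcState.cur hp)
      (congrArg ProcState.stack hp) (by rw [hp]; exact code)), rfl, hR.shared,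
      by simp only [hR.attempt], ProcRel.update hR.proc (.run _ _ [])⟩
  | opRespond p l r cur stack code =>
    have hp := (hR.proc p).of_stack_eq_nil stack
    rw [cur] at hp
    refine ⟨_, _, hrun.snoc (.opRespond c p l r (congrArg ProcState.cur hp)
      (congrArg ProcState.stack hp) (by rw [hp]; exact code)), rfl, hR.shared,
      by simp only [hR.attempt],
      ProcRel.update hR.proc ?_⟩
    rw [hp]
    exact .run _ _ []
  | helpAct p l d h' h₁' rest' i' sh' g' call cur stack code eff =>
    obtain ⟨rest, rfl, ⟨h, rfl, hp⟩ | ⟨v, g, h, rfl, hp⟩ | ⟨g, h, rfl, hp⟩⟩ :=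
      (hR.proc p).of_stack_eq_cons cur stack
    · obtain ⟨i, hi, rfl⟩ := Algorithm.transform_helpCode_run code
      obtain ⟨V, c₁, h₁, h₂, h₃⟩ := hR.simulate_helpAct hA hrun hp hi eff
      exact ⟨V, c₁, h₁, h₂, h₃⟩
    · -- The check succeeds; the original algorithm has already moved on.
      cases code
      cases eff
      refine ⟨[], c, by rwa [List.append_nil], rfl, hR.shared, hR.attempt,
        ProcRel.update_right hR.proc ?_⟩
      rw [hp]
      exact .run g (some l) ((d, h) :: rest)
    · cases code
  | helpRet p l d h' rest' cur stack code =>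
    obtain ⟨rest, rfl, ⟨h, rfl, hp⟩ | ⟨v, g, h, rfl, hp⟩ | ⟨g, h, rfl, hp⟩⟩ :=
      (hR.proc p).of_stack_eq_cons cur stack
    · have hcode := Algorithm.transform_helpCode_run_ret code
      refine ⟨_, _, hrun.snoc (.helpRet c p l d h rest (by rw [hp]) (by rw [hp])
        (by rw [hp]; exact hcode)), rfl, hR.shared, hR.attempt, ProcRel.update hR.proc ?_⟩
      rw [hp]
      exact .run _ _ _
    · cases code
    · -- The check fails; the original algorithm has already returned.
      refine ⟨[], c, by rwa [List.append_nil], rfl, hR.shared, hR.attempt,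
        ProcRel.update_right hR.proc ?_⟩
      rw [hp]
      exact .run _ _ _

theorem Algorithm.IsWCA.exists_execution_history_eq [Infinite S.Ptr] (hA : A.IsWCA)
    (e' : Execution .weakDesc A.transform) :
    ∃ e : Execution .mutableDesc A, e.history = e'.history := by
  obtain ⟨W, hW, hmono⟩ := exists_growing_lists
    (P := fun i W => ∃ c, Run .mutableDesc A W c ∧ ConfRel c (e'.conf i) ∧
      traceEvents W = e'.events i) (W₀ := [])
    ⟨_, .nil, by rw [e'.start]; exact .initial, rfl⟩ (by
      rintro i W ⟨c, hrun, hR, hev⟩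
      cases hl : e'.label i with
      | none =>
        refine ⟨W, ⟨c, hrun, by rw [(e'.ended i hl).2]; exact hR, ?_⟩, List.prefix_refl _⟩
        rw [e'.events_succ, hl, hev]
        simp
      | some a =>
        obtain ⟨V, c₁, hrun₁, hV, hR₁⟩ := hR.simulate_step hA hrun (e'.step i a hl)
        refine ⟨W ++ V, ⟨c₁, hrun₁, hR₁, ?_⟩, List.prefix_append _ _⟩
        rw [e'.events_succ, hl, ← hev]
        simpa [traceEvents] using hV)
  exact _root_.exists_execution_history_eq e' hmono (fun i => ⟨_, (hW i).choose_spec.1⟩)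
    fun i => (hW i).choose_spec.2.2

end Simulation

/-- Every execution of the transformed algorithm, using weak descriptors, has the same invocations
and responses of high-level operations, in the same order, as some execution of the original
algorithm, using mutable descriptors. Hence linearizability is preserved. -/
theorem mainTheorem2 {n : ℕ} {S : Signature.{u}} [Infinite S.Ptr] (A : Algorithm n S)
    (hA : A.IsWCA) :
    (∀ e' : Execution .weakDesc A.transform,
      ∃ e : Execution .mutableDesc A, e.history = e'.history) ∧
    ∀ spec : SeqSpec S.HOp S.HResp,
      A.Linearizable .mutableDesc spec → A.transform.Linearizable .weakDesc spec := by
  have h := hA.exists_execution_history_eq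
  refine ⟨h, fun spec hlin e' => ?_⟩
  obtain ⟨e, he⟩ := h e'
  exact he ▸ hlin e
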